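/- Let $R$ be an associative ring with identity (not necessarily commutative), let $n\ge 1$, and let $M=(M_i)_{i=1}^n$ be a family of $R$-bimodules together with $R$-balanced, biadditive maps $M_i\times M_j\to M_{i+j}$, $(x,y)\mapsto xy$, for all $i,j\ge 1$ with $i+j\le n$, which are left $R$-linear in the first variable and right $R$-linear in the second (that is, with $R$-bimodule homomorphisms $M_i\otimes_R M_j\to M_{i+j}$), and which are associative: $(xy)z=x(yz)$ for $x\in M_i$, $y\in M_j$, $z\in M_k$ with $i+j+k\le n$. Let $R\ltimes_n M$ be the $n$-trivial extension of $R$ by $M$, that is, the additive group $R\oplus M_1\oplus\cdots\oplus M_n$ with the multiplication $(m_0,\dots,m_n)(m'_0,\dots,m'_n)=\big(\sum_{i+j=k}m_im'_j\big)_{0\le k\le n}$. Modules are left modules, and $\operatorname{Hom}_R$, $\operatorname{Ext}_R$ and the injective dimension $\operatorname{id}$ are those of left modules. Suppose that the canonical map $R\to\operatorname{Hom}_R(M_n,M_n)$, $r\mapsto(x\mapsto xr)$, is an isomorphism, that for every $1\le i<n$ the canonical map $M_{n-i}\to\operatorname{Hom}_R(M_i,M_n)$, $y\mapsto(x\mapsto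 xy)$, is an isomorphism, and that $\operatorname{Ext}_R^k(M_i,M_n)=0$ for all $1\le i\le n$ and all $k\ge 1$. Then $$\operatorname{id}_{R\ltimes_n M}(R\ltimes_n M)=\operatorname{id}_R(M_n).$$ -/

import Mathlib

open CategoryTheory

universe u

/-- A family of pre-products on `M₁, …, Mₙ` (indexed by the integers `1 ≤ i ≤ n`), where each `Mᵢ`
is an `R`-bimodule, the right action of `r` being the action of `MulOpposite.op r`.
It consists of `R`-balanced biadditive maps `Mᵢ × Mⱼ → Mₖ`, for `k = i + j ≤ n`, that are left
`R`-linear in the first variable and right `R`-linear in the second one (in other words, of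
homomorphisms of `R`-bimodules `Mᵢ ⊗[R] Mⱼ → Mᵢ₊ⱼ`), and that are associative. -/
structure PreProduct (R : Type u) [Ring R] {n : ℕ} (M : Set.Icc 1 n → Type u)
    [∀ i, AddCommGroup (M i)] [∀ i, Module R (M i)] [∀ i, Module Rᵐᵒᵖ (M i)] where
  φ : ∀ {i j k : Set.Icc 1 n}, (i : ℕ) + (j : ℕ) = (k : ℕ) → M i →+ M j →+ M k
  smul_left : ∀ {i j k : Set.Icc 1 n} (h : (i : ℕ) + (j : ℕ) = (k : ℕ)) (r : R) (x : M i) (y : M j),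
    φ h (r • x) y = r • φ h x y
  smul_right : ∀ {i j k : Set.Icc 1 n} (h : (i : ℕ) + (j : ℕ) = (k : ℕ)) (r : R) (x : M i) (y : M j),
    φ h x (MulOpposite.op r • y) = MulOpposite.op r • φ h x y
  balanced : ∀ {i j k : Set.Icc 1 n} (h : (i : ℕ) + (j : ℕ) = (k : ℕ)) (r : R) (x : M i) (y : M j),
    φ h (MulOpposite.op r • x) y = φ h x (r • y)
  assoc : ∀ {i j k ij jk l : Set.Icc 1 n} (hij : (i : ℕ) + (j : ℕ) = (ij : ℕ))
    (hjk : (j : ℕ) + (k : ℕ) = (jk : ℕ)) (hl : (ij : ℕ) + (k : ℕ) = (l : ℕ))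
    (hl' : (i : ℕ) + (jk : ℕ) = (l : ℕ)) (x : M i) (y : M j) (z : M k),
    φ hl (φ hij x y) z = φ hl' x (φ hjk y z)

namespace PreProduct

variable {R : Type u} [Ring R] {n : ℕ} {M : Set.Icc 1 n → Type u}
  [∀ i, AddCommGroup (M i)] [∀ i, Module R (M i)] [∀ i, Module Rᵐᵒᵖ (M i)]
  (Φ : PreProduct R M)

/-- The canonical map `Mⱼ → Hom_R(Mᵢ, Mₖ)`, `y ↦ (x ↦ x · y)`, for `i + j = k`, where `Hom_R` is the
group of homomorphisms of left `R`-modules. -/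
def toHom {i j k : Set.Icc 1 n} (h : (i : ℕ) + (j : ℕ) = (k : ℕ)) : M j →+ (M i →ₗ[R] M k) where
  toFun y :=
    { toFun := fun x => Φ.φ h x y
      map_add' := fun x x' => by simp
      map_smul' := fun r x => Φ.smul_left h r x y }
  map_zero' := by ext; simp
  map_add' y y' := by ext; simp

/-- The pre-products extended by `0` to all triples of indices. -/
def φ₀ (i j k : Set.Icc 1 n) : M i →+ M j →+ M k :=
  if h : (i : ℕ) + (j : ℕ) = (k : ℕ) then Φ.φ h else 0

theorem φ₀_smul_left (i j k : Set.Icc 1 n) (r : R) (x : M i) (y : M j) :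
    Φ.φ₀ i j k (r • x) y = r • Φ.φ₀ i j k x y := by
  unfold φ₀; split_ifs with h
  · exact Φ.smul_left h r x y
  · simp

theorem φ₀_smul_right (i j k : Set.Icc 1 n) (r : R) (x : M i) (y : M j) :
    Φ.φ₀ i j k x (MulOpposite.op r • y) = MulOpposite.op r • Φ.φ₀ i j k x y := by
  unfold φ₀; split_ifs with h
  · exact Φ.smul_right h r x y
  · simp

theorem φ₀_balanced (i j k : Set.Icc 1 n) (r : R) (x : M i) (y : M j) :
    Φ.φ₀ i j k (MulOpposite.op r • x) y = Φ.φ₀ i j k x (r • y) := by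
  unfold φ₀; split_ifs with h
  · exact Φ.balanced h r x y
  · simp

theorem φ₀_assoc (i j k l : Set.Icc 1 n) (x : M i) (y : M j) (z : M k) :
    ∑ a, Φ.φ₀ a k l (Φ.φ₀ i j a x y) z = ∑ b, Φ.φ₀ i b l x (Φ.φ₀ j k b y z) := by
  have hi := i.2.1
  have hk := k.2.1
  have hl := l.2.2
  have hj := j.2.1
  by_cases h : (i : ℕ) + j + k = l
  · have ha : (i : ℕ) + j ∈ Set.Icc 1 n := ⟨by omega, by omega⟩
    have hb : (j : ℕ) + k ∈ Set.Icc 1 n := ⟨by omega, by omega⟩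
    rw [Finset.sum_eq_single ⟨(i : ℕ) + j, ha⟩, Finset.sum_eq_single ⟨(j : ℕ) + k, hb⟩]
    · have h' : (i : ℕ) + (j + k) = l := by omega
      simp only [φ₀, dif_pos, h, h']
      exact Φ.assoc rfl rfl h h' x y z
    · intro b _ hb'
      have : ¬ (j : ℕ) + k = b := fun e => hb' (Subtype.ext e.symm)
      simp [φ₀, this]
    · simp
    · intro a _ ha'
      have : ¬ (i : ℕ) + j = a := fun e => ha' (Subtype.ext e.symm)
      simp [φ₀, this]
    · simp
  · rw [Finset.sum_eq_zero, Finset.sum_eq_zero]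
    · intro b _
      by_cases e : (j : ℕ) + k = b
      · have : ¬ (i : ℕ) + b = l := by omega
        simp [φ₀, this]
      · simp [φ₀, e]
    · intro a _
      by_cases e : (i : ℕ) + j = a
      · have : ¬ (a : ℕ) + k = l := by omega
        simp [φ₀, this]
      · simp [φ₀, e]

end PreProduct

/-- The `n`-trivial extension `R ⋉ₙ M`: its additive group is `R ⊕ M₁ ⊕ ⋯ ⊕ Mₙ`. -/
def NTrivialExt {R : Type u} [Ring R] {n : ℕ} {M : Set.Icc 1 n → Type u}
    [∀ i, AddCommGroup (M i)] [∀ i, Module R (M i)] [∀ i, Module Rᵐᵒᵖ (M i)]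
    (_Φ : PreProduct R M) : Type u :=
  R × (∀ i, M i)

namespace NTrivialExt

variable {R : Type u} [Ring R] {n : ℕ} {M : Set.Icc 1 n → Type u}
  [∀ i, AddCommGroup (M i)] [∀ i, Module R (M i)] [∀ i, Module Rᵐᵒᵖ (M i)]
  {Φ : PreProduct R M}

/-- The degree `0` component. -/
def scalar (s : NTrivialExt Φ) : R := s.1

/-- The component in `Mᵢ`. -/
def comp (s : NTrivialExt Φ) (i : Set.Icc 1 n) : M i := s.2 i

@[ext]
theorem ext {s t : NTrivialExt Φ} (h₀ : s.scalar = t.scalar) (h : ∀ i, s.comp i = t.comp i) :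
    s = t :=
  Prod.ext h₀ (funext h)

instance : AddCommGroup (NTrivialExt Φ) := inferInstanceAs (AddCommGroup (R × (∀ i, M i)))

instance : One (NTrivialExt Φ) := ⟨((1 : R), (0 : ∀ i, M i))⟩

/-- The component of degree `k` of a product is the sum of the products `mᵢ m'ⱼ`, `i + j = k`,
where `i` and `j` may be `0`. -/
instance : Mul (NTrivialExt Φ) :=
  ⟨fun s t => (s.scalar * t.scalar, fun k => s.scalar • t.comp k + MulOpposite.op t.scalar • s.comp k
    + ∑ i, ∑ j, Φ.φ₀ i j k (s.comp i) (t.comp j))⟩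

@[simp] theorem scalar_zero : (0 : NTrivialExt Φ).scalar = 0 := rfl
@[simp] theorem comp_zero (k) : (0 : NTrivialExt Φ).comp k = 0 := rfl
@[simp] theorem scalar_one : (1 : NTrivialExt Φ).scalar = 1 := rfl
@[simp] theorem comp_one (k) : (1 : NTrivialExt Φ).comp k = 0 := rfl
@[simp] theorem scalar_add (s t : NTrivialExt Φ) : (s + t).scalar = s.scalar + t.scalar := rfl
@[simp] theorem comp_add (s t : NTrivialExt Φ) (k) : (s + t).comp k = s.comp k + t.comp k := rfl
@[simp] theorem scalar_mul (s t : NTrivialExt Φ) : (s * t).scalar = s.scalar * t.scalar := rfl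
theorem comp_mul (s t : NTrivialExt Φ) (k) :
    (s * t).comp k = s.scalar • t.comp k + MulOpposite.op t.scalar • s.comp k
      + ∑ i, ∑ j, Φ.φ₀ i j k (s.comp i) (t.comp j) := rfl

theorem sum_rotate {ι A : Type*} [Fintype ι] [AddCommMonoid A] (f : ι → ι → ι → A) :
    ∑ a, ∑ b, ∑ c, f a b c = ∑ b, ∑ c, ∑ a, f a b c := by
  rw [Finset.sum_comm]
  exact Finset.sum_congr rfl fun _ _ => Finset.sum_comm

theorem sum_assoc (x y z : ∀ i, M i) (l : Set.Icc 1 n) :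
    ∑ a, ∑ k, Φ.φ₀ a k l (∑ i, ∑ j, Φ.φ₀ i j a (x i) (y j)) (z k) =
      ∑ i, ∑ b, Φ.φ₀ i b l (x i) (∑ j, ∑ k, Φ.φ₀ j k b (y j) (z k)) := by
  simp only [map_sum, AddMonoidHom.finsetSum_apply]
  calc _ = ∑ i, ∑ j, ∑ k, ∑ a, Φ.φ₀ a k l (Φ.φ₀ i j a (x i) (y j)) (z k) := by
        rw [Finset.sum_comm]
        exact (Finset.sum_congr rfl fun k _ => sum_rotate _).trans
          (sum_rotate fun k i j => ∑ a, Φ.φ₀ a k l (Φ.φ₀ i j a (x i) (y j)) (z k))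
    _ = ∑ i, ∑ j, ∑ k, ∑ b, Φ.φ₀ i b l (x i) (Φ.φ₀ j k b (y j) (z k)) := by
        simp_rw [PreProduct.φ₀_assoc]
    _ = _ := Finset.sum_congr rfl fun _ _ => (sum_rotate _).symm

instance [∀ i, SMulCommClass Rᵐᵒᵖ R (M i)] : Ring (NTrivialExt Φ) where
  __ := (inferInstance : AddCommGroup (NTrivialExt Φ))
  left_distrib r s t := by
    ext
    · simp [mul_add]
    · simp [comp_mul, Finset.sum_add_distrib, add_smul]; abel
  right_distrib r s t := by
    ext
    · simp [add_mul]
    · simp [comp_mul, Finset.sum_add_distrib, add_smul]; abel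
  zero_mul s := by ext <;> simp [comp_mul]
  mul_zero s := by ext <;> simp [comp_mul]
  one_mul s := by ext <;> simp [comp_mul]
  mul_one s := by ext <;> simp [comp_mul]
  mul_assoc r s t := by
    ext l
    · simp [mul_assoc]
    · have h := sum_assoc (Φ := Φ) r.comp s.comp t.comp l
      simp only [comp_mul, scalar_mul, map_add, AddMonoidHom.add_apply, Finset.sum_add_distrib,
        PreProduct.φ₀_smul_left, PreProduct.φ₀_smul_right, PreProduct.φ₀_balanced, smul_add,
        ← Finset.smul_sum, MulOpposite.op_mul, mul_smul, h,
        smul_comm (MulOpposite.op t.scalar) r.scalar]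
      abel

end NTrivialExt

/-! Write `S` for `R ⋉ₙ M`. The pairing `(t, s) ↦ (t s)ₙ` matches degree `i` with degree `n - i`,
and the hypotheses on Hom say that it is perfect: `S ≅ Hom_R(S, Mₙ)` as left `S`-modules
(`toHom_bijective`, `isoCoextendScalars`). So `S` is coinduced from `Mₙ` along `R → S`.

It remains to see that coinduction `G` preserves the injective dimension of `Mₙ`
(`injectiveDimension_coextendScalars`). Its left adjoint, restriction, is exact, so `G` preserves
injectives; the projection `S → R` gives restriction a section, so `G` also reflects injectives and
zero objects. As a left `R`-module `S = R ⊕ M₁ ⊕ ⋯ ⊕ Mₙ`, so `Ext_R^k(S, Mₙ) = 0` for `k ≥ 1`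
(`ext_subsingleton`). This vanishing passes to cosyzygies and makes `G` exact on them, so the
dimensions agree by dimension shifting. -/

namespace CategoryTheory

open Limits Abelian

/-! ### Injective dimension under a right adjoint -/

section Adjunction

variable {C D : Type*} [Category* C] [Category* D] {L : D ⥤ C} {G : C ⥤ D}

/-- If the left adjoint `L` has a section `K` preserving monomorphisms, then the right adjoint `G`
reflects injective objects. -/
theorem Adjunction.injective_of_injective_obj (adj : L ⊣ G) {K : C ⥤ D} (e : K ⋙ L ≅ 𝟭 C)
    [K.PreservesMonomorphisms] {E : C} (hE : Injective (G.obj E)) : Injective E where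
  factors {A B} a i _ := by
    -- Extend the transpose of `L (K A) ≅ A ⟶ E` along `K.map i`; transposing back gives the
    -- extension of `a` to `B`.
    let t := Injective.factorThru (adj.homEquiv _ _ (e.hom.app A ≫ a)) (K.map i)
    have ht : K.map i ≫ t = adj.homEquiv _ _ (e.hom.app A ≫ a) := Injective.comp_factorThru _ _
    refine ⟨e.inv.app B ≫ (adj.homEquiv _ _).symm t, ?_⟩
    have hi : i ≫ e.inv.app B = e.inv.app A ≫ L.map (K.map i) := e.inv.naturality i
    rw [← Category.assoc, hi, Category.assoc, ← adj.homEquiv_naturality_left_symm, ht,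
      Equiv.symm_apply_apply]
    simp

/-- If the left adjoint `L` has a section `K`, then the right adjoint `G` reflects zero objects. -/
theorem Adjunction.isZero_of_isZero_obj [HasZeroMorphisms C] (adj : L ⊣ G) {K : C ⥤ D}
    (e : K ⋙ L ≅ 𝟭 C) {E : C} (hE : IsZero (G.obj E)) : IsZero E := by
  have h : e.hom.app E = 0 := (adj.homEquiv _ _).injective (hE.eq_of_tgt _ _)
  rw [IsZero.iff_id_eq_zero]
  calc 𝟙 E = e.inv.app E ≫ e.hom.app E := by simp
    _ = 0 := by rw [h, comp_zero]

end Adjunction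

variable {C D : Type*} [Category* C] [Category* D] [Abelian C] [Abelian D]

/-- Let `G` be a right adjoint of a functor `L` that preserves monomorphisms and has a section `K`
preserving monomorphisms. On a class of objects which is closed under cosyzygies and on which `G`
is exact, `G` preserves and reflects injective dimensions. -/
theorem Adjunction.hasInjectiveDimensionLT_obj_iff [EnoughInjectives C]
    {L : D ⥤ C} {G : C ⥤ D} (adj : L ⊣ G) [L.PreservesMonomorphisms]
    {K : C ⥤ D} (e : K ⋙ L ≅ 𝟭 C) [K.PreservesMonomorphisms] [G.PreservesZeroMorphisms]
    (P : ObjectProperty C)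
    (hP : ∀ S : ShortComplex C, S.ShortExact → Injective S.X₂ → P S.X₁ → P S.X₃)
    (hG : ∀ S : ShortComplex C, S.ShortExact → P S.X₁ → Epi (G.map S.g))
    {E : C} (hE : P E) (d : ℕ) :
    HasInjectiveDimensionLT (G.obj E) d ↔ HasInjectiveDimensionLT E d := by
  -- Dimension `< 0` means zero and `< 1` means injective. The shift only relates `< d + 2` to `< d
  -- + 1` for the cosyzygy, so both bottom cases are treated directly.
  match d with
  | 0 =>
    rw [hasInjectiveDimensionLT_zero_iff_isZero, hasInjectiveDimensionLT_zero_iff_isZero]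
    exact ⟨adj.isZero_of_isZero_obj e, G.map_isZero⟩
  | 1 =>
    rw [← injective_iff_hasInjectiveDimensionLT_one, ← injective_iff_hasInjectiveDimensionLT_one]
    exact ⟨adj.injective_of_injective_obj e, adj.map_injective E⟩
  | d + 2 =>
    let S := ShortComplex.mk (Injective.ι E) _ (cokernel.condition _)
    have hS : S.ShortExact := { exact := ShortComplex.exact_cokernel _ }
    have : Injective S.X₂ := inferInstanceAs (Injective (Injective.under E))
    have : PreservesLimitsOfSize.{0, 0} G := adj.rightAdjoint_preservesLimits
    -- A right adjoint is left exact; only the epimorphism needs `hG`.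
    have hSG : (S.map G).ShortExact :=
      { exact := by
          have := hS.mono_f
          exact hS.exact.map_of_mono_of_preservesKernel G inferInstance inferInstance
        mono_f := by
          have := hS.mono_f
          exact inferInstanceAs (Mono (G.map S.f))
        epi_g := hG S hS hE }
    exact (hSG.hasInjectiveDimensionLT_X₃_iff d (adj.map_injective _ ‹_›)).symm.trans
      ((adj.hasInjectiveDimensionLT_obj_iff e P hP hG (hP S hS ‹_› hE) (d + 1)).trans
        (hS.hasInjectiveDimensionLT_X₃_iff d ‹_›))

theorem injectiveDimension_eq_of_hasInjectiveDimensionLT_iff {X : C} {Y : D}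
    (h : ∀ d : ℕ, HasInjectiveDimensionLT X d ↔ HasInjectiveDimensionLT Y d) :
    injectiveDimension X = injectiveDimension Y := by
  simp only [injectiveDimension, h]

/-- Dimension shift: in the long exact sequence, `Ext^k(X, S.X₃)` lies between `Ext^k(X, S.X₂) = 0`
and `Ext^(k+1)(X, S.X₁) = 0`. -/
theorem Abelian.Ext.subsingleton_X₃_of_injective {C : Type*} [Category* C] [Abelian C] [HasExt C]
    {S : ShortComplex C} (hS : S.ShortExact) [Injective S.X₂] {X : C} {k : ℕ} (hk : 1 ≤ k)
    [Subsingleton (Ext X S.X₁ (k + 1))] : Subsingleton (Ext X S.X₃ k) := by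
  refine subsingleton_of_forall_eq 0 fun x => ?_
  obtain ⟨y, rfl⟩ := Ext.covariant_sequence_exact₃ X hS x rfl (Subsingleton.elim _ _)
  obtain _ | k := k
  · omega
  · rw [y.eq_zero_of_injective, Ext.zero_comp]

end CategoryTheory

/-! ### Coextension of scalars -/

namespace ModuleCat

open Abelian

variable {R S : Type u} [Ring R] [Ring S] (f : R →+* S)

instance : (coextendScalars.{u, u, u} f).Additive :=
  (restrictCoextendScalarsAdj.{u, u, u} f).right_adjoint_additive

/-- Surjectivity means lifting `R`-linear maps `S → T.X₃` through `T.g`; the obstruction lies in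
`Ext_R^1(S, T.X₁)`. -/
theorem epi_coextendScalars_map {T : ShortComplex (ModuleCat.{u} R)} (hT : T.ShortExact)
    [Subsingleton (Ext ((restrictScalars f).obj (of S S)) T.X₁ 1)] :
    Epi ((coextendScalars f).map T.g) := by
  rw [epi_iff_surjective]
  intro φ
  obtain ⟨x, hx⟩ := Ext.covariant_sequence_exact₃ ((restrictScalars f).obj (of S S)) hT
    (Ext.mk₀ (ofHom (X := (restrictScalars f).obj (of S S)) (CoextendScalars.equiv f _ φ)))
    (zero_add 1) (Subsingleton.elim _ _)
  obtain ⟨ψ, rfl⟩ := Ext.homEquiv₀.symm.surjective x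
  have h : ψ ≫ T.g = ofHom (X := (restrictScalars f).obj (of S S)) (CoextendScalars.equiv f _ φ) :=
    Ext.homEquiv₀.symm.injective ((Ext.mk₀_comp_mk₀ _ _).symm.trans hx)
  refine ⟨(CoextendScalars.equiv f _).symm ψ.hom, CoextendScalars.ext ?_⟩
  exact congrArg Hom.hom h

/-- Coextension of scalars along a split monomorphism of rings `f : R →+* S` preserves the injective
dimension of the modules `E` with `Ext_R^k(S, E) = 0` for all `k ≥ 1`. -/
theorem injectiveDimension_coextendScalars (g : S →+* R) (hgf : g.comp f = RingHom.id R)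
    (E : ModuleCat.{u} R)
    (hE : ∀ k, 1 ≤ k → Subsingleton (Ext ((restrictScalars f).obj (of S S)) E k)) :
    injectiveDimension ((coextendScalars f).obj E) = injectiveDimension E := by
  have e : restrictScalars.{u} g ⋙ restrictScalars f ≅ 𝟭 _ :=
    (restrictScalarsComp' f g _ rfl).symm ≪≫ restrictScalarsId' _ hgf
  refine injectiveDimension_eq_of_hasInjectiveDimensionLT_iff fun d =>
    (restrictCoextendScalarsAdj.{u, u, u} f).hasInjectiveDimensionLT_obj_iff e
      -- Vanishing is required in all positive degrees, since each cosyzygy lowers the degree by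
      -- one.
      (fun F => ∀ k, 1 ≤ k → Subsingleton (Ext ((restrictScalars f).obj (of S S)) F k))
      ?_ ?_ hE d
  · intro T hT _ h k hk
    have := h (k + 1) (by omega)
    exact Ext.subsingleton_X₃_of_injective hT hk
  · intro T hT h
    have := h 1 le_rfl
    exact epi_coextendScalars_map f hT

end ModuleCat

namespace CategoryTheory.Abelian.Ext

variable {C : Type*} [Category* C] [Abelian C] [HasExt C]

/-- `X` is a retract of the sum of the `Z i`, so every class on `X` is a sum of classes that factor
through some `Ext (Z i) Y k`. -/
theorem subsingleton_of_id_eq_sum {ι : Type*} [Fintype ι] {X Y : C} {Z : ι → C} (a : ∀ i, X ⟶ Z i)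
    (b : ∀ i, Z i ⟶ X) (h : 𝟙 X = ∑ i, a i ≫ b i) (k : ℕ) [∀ i, Subsingleton (Ext (Z i) Y k)] :
    Subsingleton (Ext X Y k) := by
  refine subsingleton_of_forall_eq 0 fun x => ?_
  rw [← x.mk₀_id_comp, h, Ext.mk₀_sum, Ext.sum_comp]
  refine Finset.sum_eq_zero fun i _ => ?_
  rw [← Ext.mk₀_comp_mk₀, Ext.comp_assoc_of_second_deg_zero,
    Subsingleton.elim ((Ext.mk₀ (b i)).comp x (zero_add k)) 0, Ext.comp_zero]

end CategoryTheory.Abelian.Ext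

/-! ### The trivial extension as a coinduced module -/

namespace NTrivialExt

variable {R : Type u} [Ring R] {n : ℕ} {M : Set.Icc 1 n → Type u}
  [∀ i, AddCommGroup (M i)] [∀ i, Module R (M i)] [∀ i, Module Rᵐᵒᵖ (M i)]
  {Φ : PreProduct R M}

/-- The inclusion of `Mᵢ` into `R ⋉ₙ M`. -/
def single (Φ : PreProduct R M) (i : Set.Icc 1 n) (x : M i) : NTrivialExt Φ :=
  ((0 : R), (Pi.single i x : ∀ i, M i))

@[simp] theorem scalar_single (i : Set.Icc 1 n) (x : M i) : (single Φ i x).scalar = 0 := rfl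

theorem comp_single (i : Set.Icc 1 n) (x : M i) (k : Set.Icc 1 n) :
    (single Φ i x).comp k = (Pi.single i x : ∀ i, M i) k := rfl

@[simp] theorem comp_single_same (i : Set.Icc 1 n) (x : M i) : (single Φ i x).comp i = x :=
  Pi.single_eq_same i x

theorem comp_single_of_ne {i k : Set.Icc 1 n} (h : k ≠ i) (x : M i) :
    (single Φ i x).comp k = 0 :=
  Pi.single_eq_of_ne h x

theorem comp_single_mul (i : Set.Icc 1 n) (x : M i) (s : NTrivialExt Φ) (k : Set.Icc 1 n) :
    (single Φ i x * s).comp k =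
      MulOpposite.op s.scalar • (single Φ i x).comp k + ∑ j, Φ.φ₀ i j k x (s.comp j) := by
  rw [comp_mul, Finset.sum_eq_single i]
  · simp
  · intro j _ hj
    simp [comp_single_of_ne hj]
  · simp

theorem comp_single_mul_same (i : Set.Icc 1 n) (x : M i) (s : NTrivialExt Φ) :
    (single Φ i x * s).comp i = MulOpposite.op s.scalar • x := by
  rw [comp_single_mul, Finset.sum_eq_zero, add_zero, comp_single_same]
  intro j _
  have hj := j.2.1
  have : ¬ (i : ℕ) + j = i := by omega
  rw [PreProduct.φ₀, dif_neg this]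
  rfl

theorem comp_single_mul_of_add_eq {i j k : Set.Icc 1 n} (h : (i : ℕ) + (j : ℕ) = (k : ℕ)) (x : M i)
    (s : NTrivialExt Φ) : (single Φ i x * s).comp k = Φ.φ h x (s.comp j) := by
  have hj := j.2.1
  have hki : k ≠ i := fun e => by rw [e] at h; omega
  rw [comp_single_mul, comp_single_of_ne hki, smul_zero, zero_add, Finset.sum_eq_single j]
  · simp [PreProduct.φ₀, h]
  · intro b _ hb
    have : ¬ (i : ℕ) + b = k := fun e => hb (Subtype.ext (by omega))
    simp [PreProduct.φ₀, this]
  · simp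

variable [∀ i, SMulCommClass Rᵐᵒᵖ R (M i)]

/-- The inclusion of `R` into `R ⋉ₙ M`. -/
def inclusion (Φ : PreProduct R M) : R →+* NTrivialExt Φ where
  toFun r := (r, (0 : ∀ i, M i))
  map_one' := rfl
  map_zero' := rfl
  map_add' r s := Prod.ext rfl (add_zero (0 : ∀ i, M i)).symm
  map_mul' r s := by
    ext k
    · rfl
    · change (0 : M k) = r • (0 : M k) + MulOpposite.op s • (0 : M k)
        + ∑ i, ∑ j, Φ.φ₀ i j k 0 0
      simp

@[simp] theorem scalar_inclusion (r : R) : (inclusion Φ r).scalar = r := rfl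
@[simp] theorem comp_inclusion (r : R) (k : Set.Icc 1 n) : (inclusion Φ r).comp k = 0 := rfl

/-- The projection of `R ⋉ₙ M` onto `R`. -/
def projection (Φ : PreProduct R M) : NTrivialExt Φ →+* R where
  toFun := scalar
  map_one' := rfl
  map_zero' := rfl
  map_add' _ _ := rfl
  map_mul' _ _ := rfl

theorem projection_comp_inclusion : (projection Φ).comp (inclusion Φ) = RingHom.id R := rfl

/-- The left `R`-module structure of `R ⋉ₙ M`. -/
instance : Module R (NTrivialExt Φ) := Module.compHom _ (inclusion Φ)

theorem smul_def (r : R) (s : NTrivialExt Φ) : r • s = inclusion Φ r * s := rfl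

@[simp] theorem scalar_smul (r : R) (s : NTrivialExt Φ) : (r • s).scalar = r * s.scalar := rfl

@[simp] theorem comp_smul (r : R) (s : NTrivialExt Φ) (k : Set.Icc 1 n) :
    (r • s).comp k = r • s.comp k := by
  simp [smul_def, comp_mul]

/-- `NTrivialExt.scalar` as an `R`-linear map. -/
@[simps]
def scalarₗ (Φ : PreProduct R M) : NTrivialExt Φ →ₗ[R] R where
  toFun := scalar
  map_add' _ _ := rfl
  map_smul' _ _ := rfl

/-- `NTrivialExt.comp` as an `R`-linear map. -/
@[simps]
def compₗ (Φ : PreProduct R M) (i : Set.Icc 1 n) : NTrivialExt Φ →ₗ[R] M i where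
  toFun s := s.comp i
  map_add' _ _ := rfl
  map_smul' _ _ := comp_smul _ _ _

/-- `NTrivialExt.single` as an `R`-linear map. -/
@[simps]
def singleₗ (Φ : PreProduct R M) (i : Set.Icc 1 n) : M i →ₗ[R] NTrivialExt Φ where
  toFun := single Φ i
  map_add' x y := by
    ext k
    · simp
    · simp [comp_single, Pi.single_add]
  map_smul' r x := by
    ext k
    · simp
    · simp [comp_single, Pi.single_smul]

theorem comp_sum {ι : Type*} (t : Finset ι) (s : ι → NTrivialExt Φ) (k : Set.Icc 1 n) :
    (∑ i ∈ t, s i).comp k = ∑ i ∈ t, (s i).comp k :=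
  map_sum (compₗ Φ k) s t

theorem scalar_sum {ι : Type*} (t : Finset ι) (s : ι → NTrivialExt Φ) :
    (∑ i ∈ t, s i).scalar = ∑ i ∈ t, (s i).scalar :=
  map_sum (scalarₗ Φ) s t

theorem eq_smul_one_add_sum_single (s : NTrivialExt Φ) :
    s = s.scalar • (1 : NTrivialExt Φ) + ∑ i, single Φ i (s.comp i) := by
  ext k
  · simp [scalar_sum]
  · rw [comp_add, comp_smul, comp_one, smul_zero, zero_add, comp_sum, Finset.sum_eq_single k]
    · simp
    · intro b _ hb
      exact comp_single_of_ne hb.symm _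
    · simp

theorem linearMap_ext {E : Type*} [AddCommGroup E] [Module R E] {f g : NTrivialExt Φ →ₗ[R] E}
    (h₁ : f 1 = g 1) (h : ∀ i x, f (single Φ i x) = g (single Φ i x)) : f = g := by
  ext s
  rw [eq_smul_one_add_sum_single s]
  simp only [map_add, map_smul, map_sum, h₁, h]

/-- The map `R ⋉ₙ M → Hom_R(R ⋉ₙ M, Mₖ)` that sends `s` to `t ↦ (t s)ₖ`. -/
@[simps]
def toHom (Φ : PreProduct R M) (k : Set.Icc 1 n) :
    NTrivialExt Φ →+ (NTrivialExt Φ →ₗ[R] M k) where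
  toFun s :=
    { toFun := fun t => (t * s).comp k
      map_add' := fun t t' => by rw [add_mul, comp_add]
      map_smul' := fun r t => by rw [smul_def, mul_assoc, ← smul_def, comp_smul, RingHom.id_apply] }
  map_zero' := by ext; simp
  map_add' s s' := by ext; simp [mul_add]

/-- An `R`-linear map on `R ⋉ₙ M` is determined by its value at `1` and its restrictions to the
`Mᵢ`. For `t ↦ (t s)ₙ`, the value at `1` is `sₙ`, the restriction to `Mₙ` is right multiplication by
`s₀`, and the restriction to `Mᵢ`, `i < n`, is right multiplication by `sₙ₋ᵢ`. -/
theorem toHom_bijective (hn : 1 ≤ n)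
    (hR : Function.Bijective
      (Module.toModuleEnd R (S := Rᵐᵒᵖ) (M ⟨n, hn, le_rfl⟩)))
    (hHom : ∀ (i j : Set.Icc 1 n) (h : (i : ℕ) + (j : ℕ) = n),
      Function.Bijective (Φ.toHom (k := ⟨n, hn, le_rfl⟩) h)) :
    Function.Bijective (toHom Φ ⟨n, hn, le_rfl⟩) := by
  have hlt : ∀ i : Set.Icc 1 n, i ≠ ⟨n, hn, le_rfl⟩ → (i : ℕ) < n := fun i hi =>
    lt_of_le_of_ne i.2.2 fun e => hi (Subtype.ext e)
  constructor
  · rw [injective_iff_map_eq_zero]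
    intro s hs
    have hs' (t : NTrivialExt Φ) : (t * s).comp ⟨n, hn, le_rfl⟩ = 0 := LinearMap.congr_fun hs t
    ext j
    · refine MulOpposite.op_injective (hR.1 (LinearMap.ext fun x => ?_))
      simpa [comp_single_mul_same] using hs' (single Φ _ x)
    · by_cases hj : j = ⟨n, hn, le_rfl⟩
      · subst hj
        simpa using hs' 1
      · have hjn := hlt j hj
        have hj1 := j.2.1
        have h : n - (j : ℕ) + j = n := by omega
        refine (hHom ⟨n - j, by omega, by omega⟩ j h).1 (LinearMap.ext fun x => ?_)
        have := hs' (single Φ ⟨n - j, by omega, by omega⟩ x)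
        rw [comp_single_mul_of_add_eq h] at this
        simpa [PreProduct.toHom] using this
  · intro ψ
    obtain ⟨r, hr⟩ := hR.2 (ψ.comp (singleₗ Φ _))
    -- Both clauses are stated for every `j` so that one choice yields the whole family: for `j = n`
    -- the second is vacuous because `i ≥ 1`, and for `j < n` the first is.
    have hex (j : Set.Icc 1 n) : ∃ y : M j,
        (∀ e : j = ⟨n, hn, le_rfl⟩, e ▸ y = ψ 1) ∧
        ∀ (i : Set.Icc 1 n) (h : (i : ℕ) + j = n), Φ.toHom (k := ⟨n, hn, le_rfl⟩) h y =
          ψ.comp (singleₗ Φ i) := by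
      by_cases hj : j = ⟨n, hn, le_rfl⟩
      · subst hj
        exact ⟨ψ 1, fun _ => rfl, fun i h => absurd i.2.1 (by simp at h; omega)⟩
      · have hjn := hlt j hj
        have hj1 := j.2.1
        obtain ⟨i', hi'⟩ : ∃ i' : Set.Icc 1 n, (i' : ℕ) + j = n :=
          ⟨⟨n - j, by omega, by omega⟩, Nat.sub_add_cancel hjn.le⟩
        obtain ⟨y, hy⟩ := (hHom i' j hi').2 (ψ.comp (singleₗ Φ _))
        refine ⟨y, fun e => absurd e hj, fun i h => ?_⟩
        obtain rfl : i = i' := Subtype.ext (by omega)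
        exact hy
    choose y hy₁ hy₂ using hex
    let s : NTrivialExt Φ := (MulOpposite.unop r, y)
    refine ⟨s, linearMap_ext ?_ fun i x => ?_⟩
    · rw [toHom_apply_apply, one_mul]
      exact hy₁ _ rfl
    · rw [toHom_apply_apply]
      by_cases hi : i = ⟨n, hn, le_rfl⟩
      · subst hi
        rw [comp_single_mul_same]
        exact LinearMap.congr_fun hr x
      · have hin := hlt i hi
        have hi1 := i.2.1
        have h : (i : ℕ) + (n - i) = n := by omega
        rw [comp_single_mul_of_add_eq (j := ⟨n - i, by omega, by omega⟩) h]
        exact LinearMap.congr_fun (hy₂ ⟨n - i, by omega, by omega⟩ i h) x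

theorem ext_subsingleton (E : ModuleCat.{u} R) (k : ℕ) (hk : 1 ≤ k)
    (h : ∀ i, Subsingleton (Abelian.Ext (ModuleCat.of R (M i)) E k)) :
    Subsingleton (Abelian.Ext (ModuleCat.of R (NTrivialExt Φ)) E k) := by
  have h₀ : Subsingleton (Abelian.Ext (ModuleCat.of R R) E k) := by
    obtain ⟨k, rfl⟩ := Nat.exists_eq_add_of_le' hk
    exact subsingleton_of_forall_eq 0 fun x => x.eq_zero_of_projective
  let Z : Option (Set.Icc 1 n) → ModuleCat.{u} R :=
    fun o => o.elim (ModuleCat.of R R) fun i => ModuleCat.of R (M i)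
  have (o : Option (Set.Icc 1 n)) : Subsingleton (Abelian.Ext (Z o) E k) := by
    cases o
    exacts [h₀, h _]
  refine Abelian.Ext.subsingleton_of_id_eq_sum (Z := Z)
    (fun | none => ModuleCat.ofHom (scalarₗ Φ) | some i => ModuleCat.ofHom (compₗ Φ i))
    (fun | none => ModuleCat.ofHom (LinearMap.toSpanSingleton R _ 1)
         | some i => ModuleCat.ofHom (singleₗ Φ i)) ?_ k
  refine ModuleCat.hom_ext (LinearMap.ext fun s : NTrivialExt Φ => ?_)
  rw [Fintype.sum_option]
  simpa [ModuleCat.hom_sum, Z] using eq_smul_one_add_sum_single s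

/-- If `toHom Φ k` is bijective, then the left module `R ⋉ₙ M` is coinduced from `Mₖ`. -/
noncomputable def isoCoextendScalars (k : Set.Icc 1 n) (h : Function.Bijective (toHom Φ k)) :
    ModuleCat.of (NTrivialExt Φ) (NTrivialExt Φ) ≅
      (ModuleCat.coextendScalars (inclusion Φ)).obj (ModuleCat.of R (M k)) :=
  let F : NTrivialExt Φ →ₗ[NTrivialExt Φ]
      (ModuleCat.coextendScalars (inclusion Φ)).obj (ModuleCat.of R (M k)) :=
    { toFun := fun s => (ModuleCat.CoextendScalars.equiv (inclusion Φ) _).symm (toHom Φ k s)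
      map_add' := fun s t => congrArg _ (map_add (toHom Φ k) s t)
      -- `s` acts on a coinduced map by `a ↦ φ (a s)`, so linearity is associativity.
      map_smul' := fun s t => ModuleCat.CoextendScalars.ext <| LinearMap.ext fun a : NTrivialExt Φ =>
        show (a * (s * t)).comp k = ((a * s) * t).comp k by rw [mul_assoc] }
  -- The coinduced module consists of the `R`-linear maps themselves, so `h` serves as bijectivity
  -- of `F`.
  (LinearEquiv.ofBijective F h).toModuleIso

end NTrivialExt

theorem theorem4 (R : Type u) [Ring R] (n : ℕ) (hn : 1 ≤ n) (M : Set.Icc 1 n → Type u)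
    [∀ i, AddCommGroup (M i)] [∀ i, Module R (M i)] [∀ i, Module Rᵐᵒᵖ (M i)]
    [∀ i, SMulCommClass Rᵐᵒᵖ R (M i)] (Φ : PreProduct R M)
    (hR : Function.Bijective
      (Module.toModuleEnd R (S := Rᵐᵒᵖ) (M ⟨n, hn, le_rfl⟩)))
    (hHom : ∀ (i j : Set.Icc 1 n) (h : (i : ℕ) + (j : ℕ) = n),
      Function.Bijective (Φ.toHom (k := ⟨n, hn, le_rfl⟩) h))
    (hExt : ∀ (i : Set.Icc 1 n) (k : ℕ), 1 ≤ k →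
      Subsingleton (Abelian.Ext (ModuleCat.of R (M i)) (ModuleCat.of R (M ⟨n, hn, le_rfl⟩)) k)) :
    injectiveDimension (ModuleCat.of (NTrivialExt Φ) (NTrivialExt Φ)) =
      injectiveDimension (ModuleCat.of R (M ⟨n, hn, le_rfl⟩)) :=
  (injectiveDimension_eq_of_iso (NTrivialExt.isoCoextendScalars _
    (NTrivialExt.toHom_bijective hn hR hHom))).trans
    (ModuleCat.injectiveDimension_coextendScalars (NTrivialExt.inclusion Φ)
      (NTrivialExt.projection Φ) NTrivialExt.projection_comp_inclusion _
      fun k hk => NTrivialExt.ext_subsingleton _ k hk fun i => hExt i k hk)
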